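/- **Conventions.** Ordered groups are totally ordered abelian groups, written additively. For an ordered group $\Gamma$ and $a\in\Gamma$ let $H(a)=\{b\in\Gamma : |b|\le n|a| \text{ for some } n\in\mathbb N\}$ be the principal convex subgroup generated by $a$, and let $\operatorname{Prin}(\Gamma)$ be the set of nonzero principal convex subgroups, totally ordered by *descending* inclusion. An embedding $\iota\colon\Gamma\hookrightarrow\Lambda$ of ordered groups is *commensurable* if $\Lambda/\iota(\Gamma)$ is a torsion group, and *preserves the rank* if the induced embedding $\operatorname{Prin}(\Gamma)\hookrightarrow\operatorname{Prin}(\Lambda)$, $H(a)\mapsto H(\iota(a))$, is onto. For a totally ordered set $J$, $\mathbb R^J_{\rm lex}$ is the group of all functions $J\to\mathbb R$ with well-ordered support, ordered lexicographically. For a ring $R$ and a valuation $\mu\colon R\to\Omega\cup\{\infty\}$ with values in an ordered group $\Omega$ (nonzero elements may have value $\infty$), $\Gamma_\mu\subset\Omega$ is the subgroup generated by the finite values of $\mu$. Two valuations $\mu,\nu$ on $R$ are *equivalent* if there is an isomorphism of ordered groups $\varphi\colon\Gamma_\mu\to\Gamma_\nu$ with $\nu=\varphi\circ\mu$ (where $\varphi(\infty)=\infty$).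 **Setting.** Let $(K,v)$ be a valued field with value group $\Gamma=v(K^*)$ and let $I=\operatorname{Prin}(\Gamma)$. For an initial segment $S$ of $I$ let $I_S=S+\{i_S\}+(I\setminus S)$ be the ordered set obtained by inserting one new element $i_S$ right after $S$. Let $\mathbb I=I\cup\{i_S : S \text{ an initial segment of } I\}$, with the total ordering that restricts to the given one on each $I_S$ and satisfies $i_S<i_T \Leftrightarrow S\subsetneq T$. Extending functions by zero, $\mathbb R^I_{\rm lex}\subset\mathbb R^{I_S}_{\rm lex}\subset\mathbb R^{\mathbb I}_{\rm lex}$; put $$\mathbb R_{\rm sme}=\bigcup_S\mathbb R^{I_S}_{\rm lex}\subset\mathbb R^{\mathbb I}_{\rm lex},$$ where $S$ runs over all initial segments of $I$. Fix an embedding of ordered groups $\ell\colon\Gamma\hookrightarrow\mathbb R^I_{\rm lex}$ such that $\min(\operatorname{supp}\ell(a))=H(a)$ for all nonzero $a\in\Gamma$; such embeddings exist by Hahn's embedding theorem. Regard $\ell$ as an embedding into $\mathbb R^{\mathbb I}_{\rm lex}$, and let $\Gamma_{\mathbb Q}=\{x\in\mathbb R^{\mathbb I}_{\rm lex} : nx\in\ell(\Gamma)\text{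 for some } n\ge1\}$ be the divisible hull of $\Gamma$ inside it. If $\nu$ is a valuation on $K[x]$ whose restriction to $K$ is equivalent to $v$, there is a unique embedding $\iota\colon\Gamma\hookrightarrow\Gamma_\nu$ of ordered groups with $\nu|_K=\iota\circ v$; we say that $\nu/v$ is commensurable, or preserves the rank, if $\iota$ is commensurable, or preserves the rank, respectively. **Proposition.** Every valuation $\mu$ on $K[x]$ whose restriction to $K$ is equivalent to $v$ is equivalent to some valuation $$\nu\colon K[x]\longrightarrow\mathbb R^{\mathbb I}_{\rm lex}\cup\{\infty\}$$ such that $\nu|_K=\ell\circ v$ and $\Gamma_\nu\subset\mathbb R_{\rm sme}$, and moreover $\Gamma_\nu\subset\Gamma_{\mathbb Q}$ if $\nu/v$ is commensurable, and $\Gamma_\nu\subset\mathbb R^I_{\rm lex}$ if $\nu/v$ preserves the rank. -/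

import Mathlib

open Polynomial

noncomputable section

/-! ### Ordered groups -/

/-- The ordered set `I = Prin(Γ)` of nonzero principal convex subgroups
`H(a) = {b | ∃ n, |b| ≤ n|a|}` of `Γ`, ordered by descending inclusion.
It is the set of archimedean classes of nonzero elements: in Mathlib,
`ArchimedeanClass.mk a ≤ ArchimedeanClass.mk b ↔ ∃ n, |b| ≤ n • |a|`, that is, `H(b) ⊆ H(a)`. -/
abbrev Prin (Γ : Type*) [AddCommGroup Γ] [LinearOrder Γ] [IsOrderedAddMonoid Γ] : Type _ :=
  FiniteArchimedeanClass Γ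

/-- The Hahn product `ℝ^I_lex`: functions `I → ℝ` with well-ordered support, ordered
lexicographically. -/
abbrev HahnPower (I : Type*) [LinearOrder I] : Type _ := Lex (HahnSeries I ℝ)

/-- For an extension `ι : Γ → Λ` of ordered groups: `Λ / Γ` is a torsion group. -/
def IsCommensurable {Γ Λ : Type*} [AddCommGroup Γ] [LinearOrder Γ]
    [AddCommGroup Λ] [LinearOrder Λ] (ι : Γ →+o Λ) : Prop :=
  ∀ x : Λ, ∃ n : ℕ, 0 < n ∧ ∃ γ : Γ, ι γ = n • x

/-- For an extension `ι : Γ → Λ` of ordered groups: every element of `Prin(Λ)` comes from `Γ`,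
that is, `Prin(Λ) \ Prin(Γ)` is empty. -/
def PreservesRank {Γ Λ : Type*} [AddCommGroup Γ] [LinearOrder Γ] [IsOrderedAddMonoid Γ]
    [AddCommGroup Λ] [LinearOrder Λ] [IsOrderedAddMonoid Λ] (ι : Γ →+o Λ) : Prop :=
  ∀ c : Prin Λ, (c : ArchimedeanClass Λ) ∈ Set.range (ArchimedeanClass.orderHom ι)

/-- `ℓ : Γ → ℝ^I_lex`, with `I = Prin(Γ)`, is an embedding of ordered groups compatible with the
identification of `Prin(Γ)` and `Prin(ℝ^I_lex)` with `I`: the least index in the support of `ℓ a`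
is the principal convex subgroup generated by `a` (and `ℓ 0 = 0` corresponds to `⊤`). -/
structure IsHahnEmbedding {Γ : Type*} [AddCommGroup Γ] [LinearOrder Γ] [IsOrderedAddMonoid Γ]
    (ℓ : Γ →+o HahnPower (Prin Γ)) : Prop where
  injective : Function.Injective ℓ
  orderTop_eq : ∀ a : Γ,
    ArchimedeanClass.mk a = FiniteArchimedeanClass.withTopOrderIso Γ (ofLex (ℓ a)).orderTop

/-- Such embeddings exist, by Hahn's embedding theorem. -/
theorem exists_isHahnEmbedding (Γ : Type*) [AddCommGroup Γ] [LinearOrder Γ]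
    [IsOrderedAddMonoid Γ] : ∃ ℓ : Γ →+o HahnPower (Prin Γ), IsHahnEmbedding ℓ := by
  obtain ⟨f, h1, h2⟩ := hahnEmbedding_isOrderedAddMonoid Γ
  exact ⟨f, h1, h2⟩

/-- The relative divisible closure of a subgroup `H` of `M`. When `M` is a divisible ordered group,
this is the divisible hull `H ⊗ ℚ`, identified with its image in `M`. -/
def relDivisibleHull {M : Type*} [AddCommGroup M] (H : AddSubgroup M) : AddSubgroup M where
  carrier := {x | ∃ n : ℕ, 0 < n ∧ n • x ∈ H}
  zero_mem' := ⟨1, one_pos, by simp⟩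
  add_mem' := by
    rintro x y ⟨n, hn, hx⟩ ⟨m, hm, hy⟩
    refine ⟨n * m, Nat.mul_pos hn hm, ?_⟩
    rw [nsmul_add]
    refine H.add_mem ?_ ?_
    · rw [mul_comm, mul_nsmul']; exact H.nsmul_mem hx m
    · rw [mul_nsmul']; exact H.nsmul_mem hy n
  neg_mem' := by
    rintro x ⟨n, hn, hx⟩
    exact ⟨n, hn, by rw [smul_neg]; exact H.neg_mem hx⟩

/-! ### The one-added-element hull -/

/-- The underlying set `I ⊔ {i_S | S ∈ Init(I)}` of the one-added-element hull `𝕀` of `I`. -/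
inductive OneAddedHull (I : Type*) [LinearOrder I] : Type _
  | incl (i : I) : OneAddedHull I
  | added (S : LowerSet I) : OneAddedHull I

namespace OneAddedHull

variable {I : Type*} [LinearOrder I]

/-- Auxiliary encoding, used only to define the order; see the four lemmas below. -/
def key : OneAddedHull I → LowerSet I ×ₗ Bool
  | incl i => toLex (LowerSet.Iic i, false)
  | added S => toLex (S, true)

theorem key_injective : Function.Injective (key (I := I)) := by
  rintro (i | S) (j | T) h
  · have h1 := congrArg (fun p => (ofLex p).1) h
    simp only [key, ofLex_toLex] at h1
    rw [LowerSet.Iic_injective h1]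
  · have h2 := congrArg (fun p => (ofLex p).2) h
    simp [key] at h2
  · have h2 := congrArg (fun p => (ofLex p).2) h
    simp [key] at h2
  · have h1 := congrArg (fun p => (ofLex p).1) h
    simp only [key, ofLex_toLex] at h1
    rw [h1]

/-- The total ordering on `𝕀`, characterized by the four lemmas that follow. -/
instance : LinearOrder (OneAddedHull I) := LinearOrder.lift' key key_injective

theorem lt_iff_key {x y : OneAddedHull I} : x < y ↔ key x < key y := Iff.rfl

theorem incl_lt_incl {i j : I} : incl i < incl j ↔ i < j := by
  have h : LowerSet.Iic i < LowerSet.Iic j ↔ i < j := by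
    rw [← not_le, ← not_le, LowerSet.Iic_le, LowerSet.mem_Iic_iff]
  simpa [lt_iff_key, key, Prod.Lex.toLex_lt_toLex] using h

theorem added_lt_added {S T : LowerSet I} : added S < added T ↔ S < T := by
  simp [lt_iff_key, key, Prod.Lex.toLex_lt_toLex]

theorem incl_lt_added {i : I} {S : LowerSet I} : incl i < added S ↔ i ∈ S := by
  rw [lt_iff_key, key, key, Prod.Lex.toLex_lt_toLex, ← LowerSet.Iic_le, le_iff_lt_or_eq]
  simp

theorem added_lt_incl {i : I} {S : LowerSet I} : added S < incl i ↔ i ∉ S := by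
  rw [lt_iff_key, key, key, Prod.Lex.toLex_lt_toLex, ← LowerSet.Iic_le, not_le]
  simp

/-- The embedding of ordered sets `I → 𝕀`. -/
def inclEmb : I ↪o OneAddedHull I :=
  OrderEmbedding.ofStrictMono incl fun _ _ h => incl_lt_incl.2 h

/-- The subset `I_S = I ∪ {i_S}` of `𝕀`. -/
def insertOne (S : LowerSet I) : Set (OneAddedHull I) := insert (added S) (Set.range incl)

/-- The embedding `ℝ^I_lex → ℝ^𝕀_lex` (extension by zero). -/
def extendHom : HahnPower I →+ HahnPower (OneAddedHull I) where
  toFun x := toLex (HahnSeries.embDomain inclEmb (ofLex x))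
  map_zero' := by simp
  map_add' x y := by simp [HahnSeries.embDomain_add]

/-- The subgroup `ℝ^A_lex` of `ℝ^𝕀_lex` of all elements with support contained in `A ⊆ 𝕀`. -/
def supportedIn (A : Set (OneAddedHull I)) : AddSubgroup (HahnPower (OneAddedHull I)) where
  carrier := {x | (ofLex x).support ⊆ A}
  zero_mem' := by simp
  add_mem' {x y} hx hy := by
    refine (HahnSeries.support_add_subset _ _).trans (Set.union_subset hx hy)
  neg_mem' {x} hx := by simpa using hx

variable (I) in
/-- `ℝ^I_lex` as a subgroup of `ℝ^𝕀_lex`. -/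
def realBase : AddSubgroup (HahnPower (OneAddedHull I)) := supportedIn (Set.range incl)

variable (I) in
/-- `ℝ_sme = ⋃_S ℝ^{I_S}_lex ⊆ ℝ^𝕀_lex`, where `S` runs over the initial segments of `I`. -/
def realSme : Set (HahnPower (OneAddedHull I)) :=
  ⋃ S : LowerSet I, (supportedIn (insertOne S) : Set (HahnPower (OneAddedHull I)))

end OneAddedHull

/-! ### Valuations -/

/-- The value group of a valuation `μ : R → Ω ∪ {∞}`: the subgroup of `Ω` generated by all finite
values. -/
def valueGroup {R Ω : Type*} [Ring R] [AddCommGroup Ω] [LinearOrder Ω] [IsOrderedAddMonoid Ω]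
    (μ : AddValuation R (WithTop Ω)) : AddSubgroup Ω :=
  AddSubgroup.closure {ω | ∃ f : R, μ f = (ω : WithTop Ω)}

/-- Two valuations are equivalent if there is an isomorphism `φ` of ordered groups between their
value groups such that `ν = φ ∘ μ`, with `φ ∞ = ∞`. -/
def ValuationEquiv {R Ω Ω' : Type*} [Ring R]
    [AddCommGroup Ω] [LinearOrder Ω] [IsOrderedAddMonoid Ω]
    [AddCommGroup Ω'] [LinearOrder Ω'] [IsOrderedAddMonoid Ω']
    (μ : AddValuation R (WithTop Ω)) (ν : AddValuation R (WithTop Ω')) : Prop :=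
  ∃ φ : valueGroup μ ≃+o valueGroup ν, ∀ (f : R) (g : WithTop (valueGroup μ)),
    μ f = g.map Subtype.val → ν f = (g.map φ).map Subtype.val

/-- `ι : Γ → Γ_ν` is the embedding of ordered groups with `ι ∘ v = ν` on `K` induced by a
valuation `ν` on `K[x]` whose restriction to `K` is equivalent to `v`. When the values of `v` fill
`Γ`, it is uniquely determined by `v` and `ν`. -/
def IsInducedEmbedding {K Γ Ω : Type*} [Field K]
    [AddCommGroup Γ] [LinearOrder Γ] [IsOrderedAddMonoid Γ]
    [AddCommGroup Ω] [LinearOrder Ω] [IsOrderedAddMonoid Ω]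
    (v : AddValuation K (WithTop Γ)) (ν : AddValuation K[X] (WithTop Ω))
    (ι : Γ →+o valueGroup ν) : Prop :=
  Function.Injective ι ∧ ∀ a : K, ν (C a) = (v a).map fun γ => (ι γ : Ω)

/-- `ν / v` is commensurable: the induced embedding `Γ → Γ_ν` is. -/
def CommensurableOver {K Γ Ω : Type*} [Field K]
    [AddCommGroup Γ] [LinearOrder Γ] [IsOrderedAddMonoid Γ]
    [AddCommGroup Ω] [LinearOrder Ω] [IsOrderedAddMonoid Ω]
    (v : AddValuation K (WithTop Γ)) (ν : AddValuation K[X] (WithTop Ω)) : Prop :=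
  ∃ ι : Γ →+o valueGroup ν, IsInducedEmbedding v ν ι ∧ IsCommensurable ι

/-- `ν / v` preserves the rank: the induced embedding `Γ → Γ_ν` does. -/
def PreservesRankOver {K Γ Ω : Type*} [Field K]
    [AddCommGroup Γ] [LinearOrder Γ] [IsOrderedAddMonoid Γ]
    [AddCommGroup Ω] [LinearOrder Ω] [IsOrderedAddMonoid Ω]
    (v : AddValuation K (WithTop Γ)) (ν : AddValuation K[X] (WithTop Ω)) : Prop :=
  ∃ ι : Γ →+o valueGroup ν, IsInducedEmbedding v ν ι ∧ PreservesRank ι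

end

set_option linter.unusedSectionVars false

/-! ### Hahn series and extension by zero -/

namespace OneAddedHull

variable {I : Type*} [LinearOrder I]

theorem extendHom_strictMono : StrictMono (extendHom (I := I)) :=
  (HahnSeries.embDomainOrderEmbedding (R := ℝ) inclEmb).strictMono

theorem ofLex_extendHom (x : HahnPower I) :
    ofLex (extendHom x) = HahnSeries.embDomain inclEmb (ofLex x) := rfl

theorem extendHom_mem_realBase (x : HahnPower I) : extendHom x ∈ realBase I := by
  intro i hi
  obtain ⟨k, -, rfl⟩ := HahnSeries.support_embDomain_subset hi
  exact ⟨k, rfl⟩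

theorem orderTop_extendHom (x : HahnPower I) :
    (ofLex (extendHom x)).orderTop = (ofLex x).orderTop.map incl := by
  rw [ofLex_extendHom, HahnSeries.orderTop_embDomain]
  rfl

theorem realBase_le_supportedIn (S : LowerSet I) : realBase I ≤ supportedIn (insertOne S) :=
  fun _ hx => Set.Subset.trans hx (Set.subset_insert _ _)

end OneAddedHull

namespace HahnPower

variable {I : Type*} [LinearOrder I]

theorem lt_of_coeff_lt {u w : HahnPower I} {i : I} (hu : i ≤ (ofLex u).orderTop)
    (hw : i ≤ (ofLex w).orderTop) (h : (ofLex u).coeff i < (ofLex w).coeff i) : u < w := by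
  refine (HahnSeries.lt_iff _ _).2 ⟨i, fun k hk => ?_, h⟩
  have hk' : (k : WithTop I) < i := WithTop.coe_lt_coe.2 hk
  rw [HahnSeries.coeff_eq_zero_of_lt_orderTop (hk'.trans_le hu),
    HahnSeries.coeff_eq_zero_of_lt_orderTop (hk'.trans_le hw)]

theorem coeff_le_of_lt {u w : HahnPower I} {i : I} (hu : i ≤ (ofLex u).orderTop)
    (hw : i ≤ (ofLex w).orderTop) (h : u < w) : (ofLex u).coeff i ≤ (ofLex w).coeff i := by
  by_contra! h'
  exact lt_asymm h (lt_of_coeff_lt hw hu h')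

theorem coeff_eq_of_lt_orderTop_sub {u w : HahnPower I} {i : I}
    (h : i < (ofLex (u - w)).orderTop) : (ofLex u).coeff i = (ofLex w).coeff i := by
  have := HahnSeries.coeff_eq_zero_of_lt_orderTop h
  rw [ofLex_sub, HahnSeries.coeff_sub] at this
  linarith

theorem orderTop_sub_eq {u w : HahnPower I} {i : I}
    (h : ∀ k < i, (ofLex u).coeff k = (ofLex w).coeff k)
    (hi : (ofLex u).coeff i ≠ (ofLex w).coeff i) : (ofLex (u - w)).orderTop = i := by
  refine HahnSeries.orderTop_eq_of_le ?_ ?_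
  · rw [HahnSeries.mem_support, ofLex_sub, HahnSeries.coeff_sub]
    exact sub_ne_zero.2 hi
  · intro k hk
    by_contra! hlt
    rw [HahnSeries.mem_support, ofLex_sub, HahnSeries.coeff_sub] at hk
    exact hk (sub_eq_zero.2 (h k hlt))

/-- The rational vector space structure; named so that both `Module` and `SMul` find it. -/
noncomputable instance instModuleRat : Module ℚ (HahnPower I) := inferInstance

noncomputable instance instSMulRat : SMul ℚ (HahnPower I) := instModuleRat.toSMul

theorem coeff_smul (q : ℚ) (x : HahnPower I) (i : I) :
    (ofLex (q • x)).coeff i = q * (ofLex x).coeff i :=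
  Rat.smul_def q ((ofLex x).coeff i)

noncomputable instance : PosSMulStrictMono ℚ (HahnPower I) where
  smul_lt_smul_of_pos_left q hq x y hxy := by
    obtain ⟨i, hi, hi'⟩ := (HahnSeries.lt_iff _ _).1 hxy
    refine (HahnSeries.lt_iff _ _).2 ⟨i, fun k hk => ?_, ?_⟩
    · rw [coeff_smul, coeff_smul, hi k hk]
    · rw [coeff_smul, coeff_smul]
      exact mul_lt_mul_of_pos_left hi' (Rat.cast_pos.2 hq)

theorem orderTop_smul {q : ℚ} (hq : q ≠ 0) (x : HahnPower I) :
    (ofLex (q • x)).orderTop = (ofLex x).orderTop := by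
  have hq' : (q : ℝ) ≠ 0 := Rat.cast_ne_zero.2 hq
  by_cases h0 : x = 0
  · rw [h0, show q • (0 : HahnPower I) = 0 from smul_zero (A := HahnPower I) q]
  · obtain ⟨i, hx⟩ := WithTop.ne_top_iff_exists.1
      (fun h => h0 (HahnSeries.orderTop_eq_top.1 h) : (ofLex x).orderTop ≠ ⊤)
    replace hx := hx.symm
    rw [hx]
    refine HahnSeries.orderTop_eq_of_le ?_ ?_
    · rw [HahnSeries.mem_support, coeff_smul]
      exact mul_ne_zero hq' (HahnSeries.coeff_orderTop_ne hx)
    · intro k hk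
      rw [HahnSeries.mem_support, coeff_smul] at hk
      have := HahnSeries.orderTop_le_of_coeff_ne_zero (right_ne_zero_of_mul hk)
      rw [hx] at this
      exact WithTop.coe_le_coe.1 this

end HahnPower

theorem StrictMono.map_abs_linearMap {D M : Type*}
    [AddCommGroup D] [LinearOrder D] [IsOrderedAddMonoid D] [Module ℚ D]
    [AddCommGroup M] [LinearOrder M] [IsOrderedAddMonoid M] [Module ℚ M]
    {f : D →ₗ[ℚ] M} (hf : StrictMono f) (d : D) : f |d| = |f d| := by
  rcases le_total 0 d with h | h
  · rw [abs_of_nonneg h, abs_of_nonneg (by simpa using hf.monotone h)]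
  · rw [abs_of_nonpos h, abs_of_nonpos (by simpa using hf.monotone h), map_neg]

/-! ### Realizing cuts -/

namespace CutRealization

open OneAddedHull

variable {I D M : Type*} [LinearOrder I]
  [AddCommGroup D] [LinearOrder D] [IsOrderedAddMonoid D] [Module ℚ D]
  [AddCommGroup M] [LinearOrder M] [IsOrderedAddMonoid M] [Module ℚ M]
  {j : D →ₗ[ℚ] M} {e : D →ₗ[ℚ] HahnPower I}

theorem abs_lt_abs_iff (hj : StrictMono j) (he : StrictMono e) {a b : D} :
    |j a| < |j b| ↔ |e a| < |e b| := by
  rw [← hj.map_abs_linearMap, ← hj.map_abs_linearMap, ← he.map_abs_linearMap,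
    ← he.map_abs_linearMap, hj.lt_iff_lt, he.lt_iff_lt]

theorem abs_lt_abs_of_orderTop_lt (hj : StrictMono j) (he : StrictMono e) {a b : D}
    (h : (ofLex (e b)).orderTop < (ofLex (e a)).orderTop) : |j a| < |j b| :=
  (abs_lt_abs_iff hj he).2 (HahnSeries.abs_lt_abs_of_orderTop_ofLex h)

theorem orderTop_abs (he : StrictMono e) (a : D) :
    (ofLex (e |a|)).orderTop = (ofLex (e a)).orderTop := by
  rw [he.map_abs_linearMap, HahnSeries.orderTop_abs]

/-- `j d` is nearer to `θ` than the size of any element whose leading index under `e` is `i`. -/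
def Near (j : D →ₗ[ℚ] M) (e : D →ₗ[ℚ] HahnPower I) (θ : M) (d : D) (i : I) : Prop :=
  ∀ a : D, (ofLex (e a)).orderTop = i → |j d - θ| < |j a|

theorem two_mul_abs_half (a : D) : |j ((1 / 2 : ℚ) • a)| + |j ((1 / 2 : ℚ) • a)| = |j a| := by
  rcases abs_cases (j ((1 / 2 : ℚ) • a)) with ⟨h, h0⟩ | ⟨h, h0⟩
  · have : j a = j ((1 / 2 : ℚ) • a) + j ((1 / 2 : ℚ) • a) := by
      rw [← map_add, ← add_smul]; norm_num
    rw [h, ← this, abs_of_nonneg (this ▸ add_nonneg h0 h0)]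
  · have : j a = j ((1 / 2 : ℚ) • a) + j ((1 / 2 : ℚ) • a) := by
      rw [← map_add, ← add_smul]; norm_num
    rw [h, ← neg_add, ← this, abs_of_neg (this ▸ add_neg h0 h0)]

theorem Near.mono (hj : StrictMono j) (he : StrictMono e)
    (hsurj : ∀ i : I, ∃ a, (ofLex (e a)).orderTop = (i : WithTop I)) {θ : M} {d : D} {i k : I}
    (h : Near j e θ d i) (hk : k ≤ i) : Near j e θ d k := by
  intro a ha
  rcases hk.eq_or_lt with rfl | hlt
  · exact h a ha
  · obtain ⟨b, hb⟩ := hsurj i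
    refine (h b hb).trans (abs_lt_abs_of_orderTop_lt hj he ?_)
    rw [ha, hb]
    exact WithTop.coe_lt_coe.2 hlt

theorem Near.lt_orderTop_sub (hj : StrictMono j) (he : StrictMono e)
    (hsurj : ∀ i : I, ∃ a, (ofLex (e a)).orderTop = (i : WithTop I)) {θ : M} {d d' : D} {i : I}
    (h : Near j e θ d i) (h' : Near j e θ d' i) : i < (ofLex (e (d - d'))).orderTop := by
  by_contra! hle
  obtain ⟨k, hk⟩ := WithTop.ne_top_iff_exists.1 (ne_top_of_le_ne_top WithTop.coe_ne_top hle)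
  rw [← hk] at hle
  have hki : k ≤ i := WithTop.coe_le_coe.1 hle
  have ha : (ofLex (e ((1 / 2 : ℚ) • (d - d')))).orderTop = k := by
    rw [map_smul, HahnPower.orderTop_smul (by norm_num), hk]
  have h1 := h.mono hj he hsurj hki _ ha
  have h2 := h'.mono hj he hsurj hki _ ha
  have h3 : |j (d - d')| ≤ |j d - θ| + |j d' - θ| := by
    rw [map_sub, ← sub_sub_sub_cancel_right (j d) (j d') θ]
    exact abs_sub _ _
  exact absurd (h3.trans_lt (add_lt_add h1 h2)) (by rw [two_mul_abs_half]; exact lt_irrefl _)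

theorem Near.coeff_eq (hj : StrictMono j) (he : StrictMono e)
    (hsurj : ∀ i : I, ∃ a, (ofLex (e a)).orderTop = (i : WithTop I)) {θ : M} {d d' : D} {i k : I}
    (h : Near j e θ d i) (h' : Near j e θ d' i) (hk : k ≤ i) :
    (ofLex (e d)).coeff k = (ofLex (e d')).coeff k := by
  refine HahnPower.coeff_eq_of_lt_orderTop_sub ?_
  rw [← map_sub]
  exact (WithTop.coe_le_coe.2 hk).trans_lt (h.lt_orderTop_sub hj he hsurj h')

theorem exists_limit (hj : StrictMono j) (he : StrictMono e)
    (hsurj : ∀ i : I, ∃ a, (ofLex (e a)).orderTop = (i : WithTop I)) (θ : M) :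
    ∃ η : HahnPower I, ∀ d i, Near j e θ d i →
      ∀ k ≤ i, (ofLex (e d)).coeff k = (ofLex η).coeff k := by
  classical
  let c : I → ℝ := fun i =>
    if h : ∃ d, Near j e θ d i then (ofLex (e h.choose)).coeff i else 0
  have hc : ∀ d i, Near j e θ d i → ∀ k ≤ i, (ofLex (e d)).coeff k = c k := by
    intro d i h k hk
    have hex : ∃ d, Near j e θ d k := ⟨d, h.mono hj he hsurj hk⟩
    simp only [c, dif_pos hex]
    exact (h.mono hj he hsurj hk).coeff_eq hj he hsurj hex.choose_spec le_rfl
  have hwf : (Function.support c).IsPWO := by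
    rw [Set.isPWO_iff_isWF, Set.isWF_iff_no_descending_seq]
    intro f hf hmem
    have h0 : ∃ d, Near j e θ d (f 0) := by
      by_contra hne
      exact hmem 0 (by simp only [c, dif_neg hne])
    obtain ⟨d, hd⟩ := h0
    refine Set.isWF_iff_no_descending_seq.1 (ofLex (e d)).isWF_support f hf fun n => ?_
    rw [HahnSeries.mem_support, hc d _ hd _ (hf.antitone (Nat.zero_le n))]
    exact hmem n
  exact ⟨toLex ⟨c, hwf⟩, hc⟩

theorem lt_of_coeff_ne (hj : StrictMono j) (he : StrictMono e)
    (hsurj : ∀ i : I, ∃ a, (ofLex (e a)).orderTop = (i : WithTop I)) {θ : M} {η : HahnPower I}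
    (hη : ∀ d i, Near j e θ d i → ∀ k ≤ i, (ofLex (e d)).coeff k = (ofLex η).coeff k)
    {d d₀ : D} {i : I} (h₀ : Near j e θ d₀ i)
    (hne : (ofLex (e d)).coeff i ≠ (ofLex η).coeff i) :
    (e d < η → j d < θ) ∧ (η < e d → θ < j d) := by
  have aux : ∀ i₀, i₀ ≤ i → (∀ k < i₀, (ofLex (e d)).coeff k = (ofLex η).coeff k) →
      (ofLex (e d)).coeff i₀ ≠ (ofLex η).coeff i₀ → |j d₀ - θ| < |j d₀ - j d| := by
    intro i₀ hi₀ hlt hne'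
    have hn := h₀.mono hj he hsurj hi₀
    rw [← map_sub]
    refine hn _ ?_
    rw [map_sub]
    refine HahnPower.orderTop_sub_eq (fun k hk => ?_) ?_
    · rw [hη d₀ i₀ hn k hk.le, hlt k hk]
    · rw [hη d₀ i₀ hn i₀ le_rfl]
      exact hne'.symm
  constructor
  · intro h
    obtain ⟨i₀, hlt, hi₀⟩ := (HahnSeries.lt_iff _ _).1 h
    have hle : i₀ ≤ i := not_lt.1 fun h' => hne (hlt i h')
    have h1 := aux i₀ hle hlt hi₀.ne
    have h2 : e d < e d₀ := (HahnSeries.lt_iff _ _).2 ⟨i₀, fun k hk => by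
      rw [hlt k hk, hη d₀ i h₀ k (hk.le.trans hle)], by rwa [hη d₀ i h₀ i₀ hle]⟩
    have h3 := hj (he.lt_iff_lt.1 h2)
    rw [abs_of_pos (sub_pos.2 h3)] at h1
    exact (sub_lt_sub_iff_left _).1 ((le_abs_self _).trans_lt h1)
  · intro h
    obtain ⟨i₀, hlt, hi₀⟩ := (HahnSeries.lt_iff _ _).1 h
    have hle : i₀ ≤ i := not_lt.1 fun h' => hne (hlt i h').symm
    have h1 := aux i₀ hle (fun k hk => (hlt k hk).symm) hi₀.ne'
    have h2 : e d₀ < e d := (HahnSeries.lt_iff _ _).2 ⟨i₀, fun k hk => by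
      rw [← hlt k hk, hη d₀ i h₀ k (hk.le.trans hle)], by rwa [hη d₀ i h₀ i₀ hle]⟩
    have h3 := hj (he.lt_iff_lt.1 h2)
    rw [abs_sub_comm, abs_sub_comm (j d₀), abs_of_pos (sub_pos.2 h3)] at h1
    exact (sub_lt_sub_iff_right _).1 ((le_abs_self _).trans_lt h1)

/-- `η` lies in the cut of `e D` corresponding to the cut of `j D` defined by `θ`. -/
def Realizes {N : Type*} [LT N] (j : D →ₗ[ℚ] M) (e : D → N) (θ : M) (η : N) : Prop :=
  ∀ d, (j d < θ → e d < η) ∧ (θ < j d → η < e d)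

theorem lt_and_lt_of_abs_lt (hj : StrictMono j) {N : Type*} [AddCommGroup N] [LinearOrder N]
    [IsOrderedAddMonoid N] {f : D →+ N} (hf : StrictMono f) {θ : M} {η : N} {d : D}
    (h1 : |θ| < |j d|) (h2 : |η| < |f d|) : (j d < θ → f d < η) ∧ (θ < j d → η < f d) := by
  rcases lt_trichotomy d 0 with h | rfl | h
  · have h1' : j d < 0 := by simpa using hj h
    have h2' : f d < 0 := by simpa using hf h
    rw [abs_of_neg h1'] at h1
    rw [abs_of_neg h2'] at h2
    have h3 := (abs_lt.1 h1).1
    have h4 := (abs_lt.1 h2).1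
    rw [neg_neg] at h3 h4
    exact ⟨fun _ => h4, fun h' => absurd h' h3.not_gt⟩
  · simp only [map_zero, abs_zero] at h1
    exact absurd h1 (abs_nonneg _).not_gt
  · have h1' : 0 < j d := by simpa using hj h
    have h2' : 0 < f d := by simpa using hf h
    rw [abs_of_pos h1'] at h1
    rw [abs_of_pos h2'] at h2
    exact ⟨fun h' => absurd h' ((le_abs_self _).trans_lt h1).not_gt,
      fun _ => (le_abs_self _).trans_lt h2⟩

end CutRealization

namespace CutRealization

open OneAddedHull

variable {I D M : Type*} [LinearOrder I]
  [AddCommGroup D] [LinearOrder D] [IsOrderedAddMonoid D] [Module ℚ D]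
  [AddCommGroup M] [LinearOrder M] [IsOrderedAddMonoid M] [Module ℚ M]
  {j : D →ₗ[ℚ] M} {e : D →ₗ[ℚ] HahnPower I}

theorem exists_realizes_of_abs_le (hj : StrictMono j) (he : StrictMono e) {θ : M}
    (hθ : ∀ d, j d ≠ θ) {x : D} {i₀ : I} (hx : (ofLex (e x)).orderTop = i₀)
    (hxθ : |θ| ≤ |j x|) (hbelow : ∀ i < i₀, Near j e θ 0 i)
    (hnear : ∀ d, ¬ Near j e θ d i₀) : ∃ η : HahnPower I, Realizes j e θ η := by
  let T : Set ℝ := {c | ∃ d, j d < θ ∧ i₀ ≤ (ofLex (e d)).orderTop ∧ (ofLex (e d)).coeff i₀ = c}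
  have hxabs : (ofLex (e |x|)).orderTop = i₀ := by rw [orderTop_abs he, hx]
  have hxneg : (ofLex (e (-|x|))).orderTop = i₀ := by
    rw [map_neg, ofLex_neg, HahnSeries.orderTop_neg, hxabs]
  have hne : T.Nonempty := by
    refine ⟨_, -|x|, lt_of_le_of_ne ?_ (hθ _), hxneg.ge, rfl⟩
    rw [map_neg, hj.map_abs_linearMap]
    exact neg_le.1 ((neg_le_abs θ).trans hxθ)
  have hbdd : BddAbove T := by
    refine ⟨(ofLex (e |x|)).coeff i₀, ?_⟩
    rintro _ ⟨d, hd, hdi, rfl⟩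
    refine HahnPower.coeff_le_of_lt hdi hxabs.ge (he (hj.lt_iff_lt.1 (hd.trans_le ?_)))
    rw [hj.map_abs_linearMap]
    exact (le_abs_self θ).trans hxθ
  set r := sSup T with hr
  let η : HahnPower I := toLex (HahnSeries.single i₀ r)
  have hηtop : (i₀ : WithTop I) ≤ (ofLex η).orderTop := HahnSeries.orderTop_single_le
  have hηc : (ofLex η).coeff i₀ = r := HahnSeries.coeff_single_same _ _
  have below : ∀ d, i₀ ≤ (ofLex (e d)).orderTop → (ofLex (e d)).coeff i₀ < r → j d < θ := by
    intro d hd hlt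
    obtain ⟨_, ⟨d', hd', hdi', rfl⟩, hlt'⟩ := exists_lt_of_lt_csSup hne hlt
    exact (hj (he.lt_iff_lt.1 (HahnPower.lt_of_coeff_lt hd hdi' hlt'))).trans hd'
  have above : ∀ d, i₀ ≤ (ofLex (e d)).orderTop → j d < θ → (ofLex (e d)).coeff i₀ ≤ r :=
    fun d hd hlt => le_csSup hbdd ⟨d, hlt, hd, rfl⟩
  have hcoeff : ∀ d, i₀ ≤ (ofLex (e d)).orderTop → (ofLex (e d)).coeff i₀ ≠ r := by
    intro d hd heq
    refine hnear d fun a ha => ?_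
    by_contra! hle
    have hab : (ofLex (e |a|)).orderTop = i₀ := by rw [orderTop_abs he, ha]
    have hβ : 0 < (ofLex (e |a|)).coeff i₀ := by
      refine lt_of_le_of_ne ?_ (HahnSeries.coeff_orderTop_ne hab).symm
      have h0 : 0 < e |a| := by
        have : a ≠ 0 := by
          rintro rfl
          rw [map_zero, ofLex_zero, HahnSeries.orderTop_zero] at ha
          exact WithTop.top_ne_coe ha
        simpa using he (abs_pos.2 this)
      exact HahnPower.coeff_le_of_lt (u := 0) (by simp) hab.ge h0
    rw [← hj.map_abs_linearMap] at hle
    rcases le_abs.1 hle with h | h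
    · have h1 : θ ≤ j (d - |a|) := by rw [map_sub]; exact le_sub_comm.1 h
      refine (below (d - |a|) ?_ ?_).not_ge h1
      · rw [map_sub, ofLex_sub]
        exact (le_min hd hab.ge).trans HahnSeries.min_orderTop_le_orderTop_sub
      · rw [map_sub, ofLex_sub, HahnSeries.coeff_sub, heq]
        linarith
    · have h1 : j (d + |a|) ≤ θ := by
        rw [map_add]
        rw [neg_sub] at h
        exact add_comm (j d) _ ▸ le_sub_iff_add_le.1 h
      have h2 := above (d + |a|) ?_ (lt_of_le_of_ne h1 (hθ _))
      · rw [map_add, ofLex_add, HahnSeries.coeff_add, heq] at h2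
        linarith
      · rw [map_add, ofLex_add]
        exact (le_min hd hab.ge).trans HahnSeries.min_orderTop_le_orderTop_add
  refine ⟨η, fun d => ?_⟩
  by_cases hd : i₀ ≤ (ofLex (e d)).orderTop
  · constructor
    · intro h
      exact HahnPower.lt_of_coeff_lt hd hηtop
        (hηc ▸ lt_of_le_of_ne (above d hd h) (hcoeff d hd))
    · intro h
      refine HahnPower.lt_of_coeff_lt hηtop hd (hηc ▸ lt_of_le_of_ne ?_ (hcoeff d hd).symm)
      by_contra! h'
      exact lt_asymm h (below d hd h')
  · rw [not_le] at hd
    obtain ⟨k, hk⟩ := WithTop.ne_top_iff_exists.1 hd.ne_top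
    have h1 : |θ| < |j d| := by
      have := hbelow k (by rw [← hk] at hd; exact WithTop.coe_lt_coe.1 hd) d hk.symm
      rwa [map_zero, zero_sub, abs_neg] at this
    exact lt_and_lt_of_abs_lt hj (f := e.toAddMonoidHom) he h1
      (HahnSeries.abs_lt_abs_of_orderTop_ofLex (hd.trans_le hηtop))

theorem exists_realizes_single (hj : StrictMono j) (he : StrictMono e) {θ : M}
    (hθ : θ ≠ 0) (S : LowerSet I)
    (hin : ∀ (d : D) (i : I), (ofLex (e d)).orderTop = (i : WithTop I) → i ∈ S → |θ| < |j d|)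
    (hout : ∀ (d : D) (i : I), (ofLex (e d)).orderTop = (i : WithTop I) → i ∉ S → |j d| < |θ|) :
    ∃ r : ℝ, r ≠ 0 ∧
      Realizes j (fun d => extendHom (e d)) θ (toLex (HahnSeries.single (added S) r)) := by
  let f : D →+ HahnPower (OneAddedHull I) := extendHom.comp e.toAddMonoidHom
  have hf : StrictMono f := extendHom_strictMono.comp he
  obtain ⟨r, hr, hrpos⟩ : ∃ r : ℝ, r ≠ 0 ∧ (0 < θ ↔ 0 < r) := by
    rcases hθ.lt_or_gt with h | h
    · exact ⟨-1, by norm_num, by simp [h.not_gt]⟩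
    · exact ⟨1, by norm_num, by simp [h]⟩
  refine ⟨r, hr, ?_⟩
  set η : HahnPower (OneAddedHull I) := toLex (HahnSeries.single (added S) r) with hη
  have hηtop : (ofLex η).orderTop = added S := HahnSeries.orderTop_single hr
  have hηpos : 0 < θ ↔ 0 < η := by
    rw [← HahnSeries.leadingCoeff_pos_iff, hη, ofLex_toLex, HahnSeries.leadingCoeff_of_single,
      hrpos]
  have hη0 : η ≠ 0 := by
    rintro h
    rw [h] at hηtop
    simp at hηtop
  have hηneg : θ < 0 ↔ η < 0 := by
    rw [← not_le, ← not_le, le_iff_lt_or_eq, le_iff_lt_or_eq, hηpos]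
    simp [hθ.symm, hη0.symm]
  intro d
  change (j d < θ → f d < η) ∧ (θ < j d → η < f d)
  by_cases hd : d = 0
  · subst hd
    simp only [map_zero]
    exact ⟨hηpos.1, hηneg.1⟩
  have hed : ofLex (e d) ≠ 0 := fun h => hd (he.injective (by rw [map_zero]; exact h))
  obtain ⟨i, hi⟩ := WithTop.ne_top_iff_exists.1 (HahnSeries.orderTop_ne_top.2 hed)
  have hfi : (ofLex (f d)).orderTop = incl i := by
    change (ofLex (extendHom (e d))).orderTop = _
    rw [orderTop_extendHom, ← hi]
    rfl
  by_cases hiS : i ∈ S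
  · refine lt_and_lt_of_abs_lt hj hf (hin d i hi.symm hiS)
      (HahnSeries.abs_lt_abs_of_orderTop_ofLex ?_)
    rw [hηtop, hfi]
    exact WithTop.coe_lt_coe.2 (incl_lt_added.2 hiS)
  · have h1 := hout d i hi.symm hiS
    have h2 : |f d| < |η| := by
      refine HahnSeries.abs_lt_abs_of_orderTop_ofLex ?_
      rw [hηtop, hfi]
      exact WithTop.coe_lt_coe.2 (added_lt_incl.2 hiS)
    rcases hθ.lt_or_gt with h | h
    · have h' := hηneg.1 h
      rw [abs_of_neg h] at h1
      rw [abs_of_neg h'] at h2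
      exact ⟨fun h3 => absurd (neg_lt_neg_iff.1 ((neg_le_abs _).trans_lt h1)) h3.not_gt,
        fun _ => neg_lt_neg_iff.1 ((neg_le_abs _).trans_lt h2)⟩
    · have h' := hηpos.1 h
      rw [abs_of_pos h] at h1
      rw [abs_of_pos h'] at h2
      exact ⟨fun _ => (le_abs_self _).trans_lt h2,
        fun h3 => absurd ((le_abs_self _).trans_lt h1) h3.not_gt⟩

theorem exists_realizes (hj : StrictMono j) (he : StrictMono e)
    (hsurj : ∀ i : I, ∃ a, (ofLex (e a)).orderTop = (i : WithTop I)) {θ : M}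
    (hθ : ∀ d, j d ≠ θ) : ∃ η : HahnPower (OneAddedHull I),
      Realizes j (fun d => extendHom (e d)) θ η ∧
      (η ∈ realBase I ∨ ∃ (S : LowerSet I) (r : ℝ) (d₀ : D), r ≠ 0 ∧
        η = extendHom (e d₀) + toLex (HahnSeries.single (added S) r)) := by
  obtain ⟨η, hη⟩ := exists_limit hj he hsurj θ
  by_cases hA : ∀ d, ∃ i, (∃ d₀, Near j e θ d₀ i) ∧ (ofLex (e d)).coeff i ≠ (ofLex η).coeff i
  · refine ⟨extendHom η, fun d => ?_, Or.inl (extendHom_mem_realBase _)⟩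
    obtain ⟨i, ⟨d₀, h₀⟩, hne⟩ := hA d
    have h := lt_of_coeff_ne hj he hsurj hη h₀ hne
    have hne' : e d ≠ η := fun h => hne (by rw [h])
    constructor
    · intro hlt
      exact extendHom_strictMono (hne'.lt_or_gt.resolve_right fun h' => lt_asymm hlt (h.2 h'))
    · intro hlt
      exact extendHom_strictMono (hne'.lt_or_gt.resolve_left fun h' => lt_asymm hlt (h.1 h'))
  push Not at hA
  obtain ⟨d₀, hd₀⟩ := hA
  set θ' := θ - j d₀ with hθ'
  have hθne : ∀ d, j d ≠ θ' := by
    intro d h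
    refine hθ (d + d₀) ?_
    rw [map_add, h, hθ', sub_add_cancel]
  have hJ : ∀ d i, Near j e θ' d i → Near j e θ' 0 i := by
    intro d i h a ha
    have h1 : Near j e θ (d + d₀) i := by
      intro b hb
      have := h b hb
      rwa [hθ', sub_sub_eq_add_sub, ← map_add] at this
    have h2 : i < (ofLex (e d)).orderTop := by
      by_contra! hle
      obtain ⟨k, hk⟩ := WithTop.ne_top_iff_exists.1 (ne_top_of_le_ne_top WithTop.coe_ne_top hle)
      rw [← hk] at hle
      have hki : k ≤ i := WithTop.coe_le_coe.1 hle
      refine HahnSeries.coeff_orderTop_ne hk.symm ?_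
      have h3 := hη _ _ h1 k hki
      rw [← hd₀ k ⟨_, h1.mono hj he hsurj hki⟩, map_add, ofLex_add, HahnSeries.coeff_add] at h3
      linarith
    have ha' : (ofLex (e ((1 / 2 : ℚ) • a))).orderTop = i := by
      rw [map_smul, HahnPower.orderTop_smul (by norm_num), ha]
    rw [map_zero, ← two_mul_abs_half]
    have h4 : |0 - θ'| ≤ |j d - θ'| + |j d| := by
      rw [zero_sub, ← sub_sub_cancel_left (j d) θ']
      exact abs_sub _ _
    exact h4.trans_lt (add_lt_add (h _ ha')
      (abs_lt_abs_of_orderTop_lt hj he (by rw [ha']; exact h2)))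
  have shift : ∀ {η' : HahnPower (OneAddedHull I)},
      Realizes j (fun d => extendHom (e d)) θ' η' →
      Realizes j (fun d => extendHom (e d)) θ (extendHom (e d₀) + η') := by
    intro η' h d
    have := h (d - d₀)
    simp only [map_sub, hθ', sub_lt_sub_iff_right] at this
    rwa [sub_lt_iff_lt_add', lt_sub_iff_add_lt'] at this
  by_cases hB : ∃ (x : D) (i₀ : I), (ofLex (e x)).orderTop = i₀ ∧ |θ'| ≤ |j x| ∧
      ¬ Near j e θ' 0 i₀
  · obtain ⟨x, i₀, hx, hxθ, hi₀⟩ := hB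
    have hbelow : ∀ i < i₀, Near j e θ' 0 i := by
      intro i hi a ha
      rw [map_zero, zero_sub, abs_neg]
      refine hxθ.trans_lt (abs_lt_abs_of_orderTop_lt hj he ?_)
      rw [ha, hx]
      exact WithTop.coe_lt_coe.2 hi
    obtain ⟨η', hη'⟩ := exists_realizes_of_abs_le hj he hθne hx hxθ hbelow
      fun d h => hi₀ (hJ d i₀ h)
    refine ⟨extendHom (e d₀) + extendHom η', shift fun d => ?_, Or.inl ?_⟩
    · exact ⟨fun h => extendHom_strictMono ((hη' d).1 h),
        fun h => extendHom_strictMono ((hη' d).2 h)⟩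
    · exact (realBase I).add_mem (extendHom_mem_realBase _) (extendHom_mem_realBase _)
  · push Not at hB
    let S : LowerSet I := ⟨{i | Near j e θ' 0 i}, fun _ _ hk h => Near.mono hj he hsurj h hk⟩
    obtain ⟨r, hr, hreal⟩ := exists_realizes_single hj he (θ := θ')
      (fun h => hθne 0 (by rw [h, map_zero])) S
      (fun d i hi hS => by
        have h := hS d hi
        rwa [map_zero, zero_sub, abs_neg] at h)
      (fun d i hi hS => by
        by_contra! hle
        exact hS (hB d i hi hle))
    exact ⟨_, shift hreal, Or.inr ⟨S, r, d₀, hr, rfl⟩⟩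

theorem exists_linear_extension {N : Type*} [AddCommGroup N] [LinearOrder N]
    [IsOrderedAddMonoid N] [Module ℚ N] [PosSMulStrictMono ℚ N] [PosSMulStrictMono ℚ M]
    (hj : StrictMono j) {f : D →ₗ[ℚ] N} (hf : StrictMono f) {θ : M} (hmem : ∀ d, j d ≠ θ)
    (hθ : ∀ x : M, ∃ (d : D) (q : ℚ), x = j d + q • θ) {η : N} (hreal : Realizes j f θ η) :
    ∃ E : M →ₗ[ℚ] N, StrictMono E ∧ (∀ d, E (j d) = f d) ∧
      ∀ (d : D) (q : ℚ), E (j d + q • θ) = f d + q • η := by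
  let g : D × ℚ →ₗ[ℚ] M := j.coprod (LinearMap.toSpanSingleton ℚ M θ)
  let h : D × ℚ →ₗ[ℚ] N := f.coprod (LinearMap.toSpanSingleton ℚ _ η)
  have pos_of_pos : ∀ (d : D) (q : ℚ), 0 < j d + q • θ → 0 < f d + q • η := by
    intro d q hp
    rcases lt_trichotomy q 0 with hq | rfl | hq
    · have h1 : θ < j ((-q⁻¹) • d) := by
        have := smul_pos (neg_pos.2 (inv_lt_zero.2 hq)) hp
        rw [smul_add, smul_smul, neg_mul, inv_mul_cancel₀ hq.ne, neg_one_smul,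
          ← sub_eq_add_neg, sub_pos, ← map_smul] at this
        exact this
      have h2 := smul_pos (neg_pos.2 hq) (sub_pos.2 ((hreal _).2 h1))
      rw [map_smul, smul_sub, smul_smul, neg_mul_neg, mul_inv_cancel₀ hq.ne, one_smul,
        neg_smul, sub_neg_eq_add] at h2
      exact h2
    · rw [zero_smul, add_zero] at hp ⊢
      rw [← map_zero j, hj.lt_iff_lt] at hp
      rw [← map_zero f, hf.lt_iff_lt]
      exact hp
    · have h1 : j ((-q⁻¹) • d) < θ := by
        have := smul_pos (inv_pos.2 hq) hp
        rw [smul_add, smul_smul, inv_mul_cancel₀ hq.ne', one_smul, ← map_smul] at this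
        rw [neg_smul, map_neg]
        exact neg_lt_iff_pos_add'.2 this
      have h2 := smul_pos hq (sub_pos.2 ((hreal _).1 h1))
      rw [map_smul, smul_sub, smul_smul, mul_neg, mul_inv_cancel₀ hq.ne', neg_one_smul,
        sub_neg_eq_add, add_comm] at h2
      exact h2
  have hg : ∀ p : D × ℚ, g p = j p.1 + p.2 • θ := fun _ => rfl
  have hginj : Function.Injective g := by
    rw [injective_iff_map_eq_zero]
    rintro ⟨d, q⟩ hp
    rw [hg] at hp
    simp only at hp
    have hq : q = 0 := by
      by_contra hq
      refine hmem ((-q⁻¹) • d) ?_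
      have h1 : θ = q⁻¹ • q • θ := by rw [smul_smul, inv_mul_cancel₀ hq, one_smul]
      rw [map_smul, h1, ← neg_eq_of_add_eq_zero_right hp, neg_smul, smul_neg]
    subst hq
    rw [zero_smul, add_zero, ← map_zero j] at hp
    rw [hj.injective hp]
    rfl
  let gE := LinearEquiv.ofBijective g
    ⟨hginj, fun x => by obtain ⟨d, q, rfl⟩ := hθ x; exact ⟨(d, q), rfl⟩⟩
  let E : M →ₗ[ℚ] N := h.comp gE.symm.toLinearMap
  have hE : ∀ (d : D) (q : ℚ), E (j d + q • θ) = f d + q • η := fun d q =>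
    congrArg h (gE.symm_apply_apply (d, q))
  refine ⟨E, fun x y hxy => ?_, fun d => ?_, hE⟩
  swap
  · have h := hE d 0
    rwa [zero_smul, zero_smul, add_zero, add_zero] at h
  rw [← sub_pos, ← map_sub]
  obtain ⟨d, q, hp⟩ := hθ (y - x)
  rw [hp, hE]
  exact pos_of_pos d q (hp ▸ sub_pos.2 hxy)

/-- If `j D` has codimension at most one in `M`, the embedding `e` extends to `M`. -/
theorem exists_extension (hj : StrictMono j) (he : StrictMono e)
    (hsurj : ∀ i : I, ∃ a, (ofLex (e a)).orderTop = (i : WithTop I)) (θ : M)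
    (hθ : ∀ x : M, ∃ (d : D) (q : ℚ), x = j d + q • θ) [PosSMulStrictMono ℚ M] :
    ∃ E : M →ₗ[ℚ] HahnPower (OneAddedHull I), StrictMono E ∧
      (∀ d, E (j d) = extendHom (e d)) ∧
      ((∀ x, E x ∈ realBase I) ∨ ∃ S : LowerSet I, (∀ x, E x ∈ supportedIn (insertOne S)) ∧
        ∃ x, (ofLex (E x)).orderTop = added S) := by
  let f : D →ₗ[ℚ] HahnPower (OneAddedHull I) := (extendHom.comp e.toAddMonoidHom).toRatLinearMap
  have hfe : ∀ d, f d = extendHom (e d) := fun _ => rfl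
  have hf : StrictMono f := extendHom_strictMono.comp he
  have smul_mem : ∀ (B : AddSubgroup (HahnPower (OneAddedHull I))) (A : Set (OneAddedHull I)),
      B = supportedIn A → ∀ (q : ℚ) (x), x ∈ B → q • x ∈ B := by
    rintro _ A rfl q x hx i hi
    refine hx ?_
    rw [HahnSeries.mem_support, HahnPower.coeff_smul] at hi
    exact (HahnSeries.mem_support _ _).2 (right_ne_zero_of_mul hi)
  by_cases hmem : ∃ d, j d = θ
  · obtain ⟨d₀, rfl⟩ := hmem
    have hbij : Function.Bijective j := by
      refine ⟨hj.injective, fun x => ?_⟩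
      obtain ⟨d, q, rfl⟩ := hθ x
      exact ⟨d + q • d₀, by rw [map_add, map_smul]⟩
    let jE := LinearEquiv.ofBijective j hbij
    have hjE : ∀ d, jE.symm (j d) = d := fun d => jE.symm_apply_apply d
    refine ⟨f.comp jE.symm.toLinearMap, fun x y hxy => hf ?_, fun d => ?_, Or.inl fun x => ?_⟩
    · obtain ⟨a, rfl⟩ := hbij.2 x
      obtain ⟨b, rfl⟩ := hbij.2 y
      change jE.symm (j a) < jE.symm (j b)
      rw [hjE, hjE]
      exact hj.lt_iff_lt.1 hxy
    · change f (jE.symm (j d)) = _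
      rw [hjE, hfe]
    · exact extendHom_mem_realBase _
  push Not at hmem
  obtain ⟨η, hreal, hη⟩ := exists_realizes hj he hsurj hmem
  obtain ⟨E, hEmono, hEj, hE⟩ := exists_linear_extension hj hf hmem hθ hreal
  refine ⟨E, hEmono, hEj, ?_⟩
  rcases hη with hη | ⟨S, r, d₀, hr, rfl⟩
  · refine Or.inl fun x => ?_
    obtain ⟨d, q, rfl⟩ := hθ x
    rw [hE, hfe]
    exact add_mem (extendHom_mem_realBase _) (smul_mem _ _ rfl _ _ hη)
  · refine Or.inr ⟨S, fun x => ?_, j (-d₀) + (1 : ℚ) • θ, ?_⟩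
    · obtain ⟨d, q, rfl⟩ := hθ x
      rw [hE, hfe]
      have hb : ∀ y : HahnPower I, extendHom y ∈ supportedIn (insertOne S) := fun y =>
        realBase_le_supportedIn S (extendHom_mem_realBase y)
      refine add_mem (hb _) (smul_mem _ _ rfl _ _ (add_mem (hb _) ?_))
      intro i hi
      rw [HahnSeries.eq_of_mem_support_single hi]
      exact Set.mem_insert _ _
    · rw [hE, map_neg, hfe, one_smul, neg_add_cancel_left]
      exact HahnSeries.orderTop_single hr

end CutRealization

/-! ### Divisible hulls -/

theorem DivisibleHull.exists_linear_extension {G N : Type*}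
    [AddCommGroup G] [LinearOrder G] [IsOrderedAddMonoid G]
    [AddCommGroup N] [LinearOrder N] [IsOrderedAddMonoid N] [Module ℚ N] [PosSMulStrictMono ℚ N]
    (f : G →+ N) (hf : StrictMono f) :
    ∃ F : DivisibleHull G →ₗ[ℚ] N, StrictMono F ∧ ∀ (g : G) (s : ℕ+),
      F (DivisibleHull.mk g s) = (s : ℚ)⁻¹ • f g := by
  have hpos : ∀ s : ℕ+, (0 : ℚ) < (s : ℕ) := fun s => Nat.cast_pos.2 s.pos
  have cancel : ∀ (s t : ℕ+) (m : G),
      (s : ℚ)⁻¹ • f m = ((s : ℚ) * t)⁻¹ • f ((t : ℕ) • m) := by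
    intro s t m
    rw [map_nsmul, ← Nat.cast_smul_eq_nsmul ℚ, smul_smul, mul_inv, mul_assoc,
      inv_mul_cancel₀ (hpos t).ne', mul_one]
  let F₀ : DivisibleHull G → N := fun x => x.liftOn (fun m s => (s : ℚ)⁻¹ • f m) (by
    intro m m' s s' h
    rw [DivisibleHull.mk_eq_mk_iff_smul_eq_smul] at h
    rw [cancel s s' m, cancel s' s m', h, mul_comm])
  have hF₀ : ∀ m s, F₀ (DivisibleHull.mk m s) = (s : ℚ)⁻¹ • f m := fun _ _ => rfl
  let F : DivisibleHull G →+ N := AddMonoidHom.mk' F₀ (by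
    intro x y
    induction x with | mk m s
    induction y with | mk m' s'
    rw [DivisibleHull.mk_add_mk, hF₀, hF₀, hF₀, map_add, smul_add, PNat.mul_coe, Nat.cast_mul,
      ← cancel, mul_comm, ← cancel])
  refine ⟨F.toRatLinearMap, ?_, hF₀⟩
  intro x y hxy
  induction x with | mk m s
  induction y with | mk m' s'
  rw [DivisibleHull.mk_lt_mk] at hxy
  change F₀ (.mk m s) < F₀ (.mk m' s')
  rw [hF₀, hF₀, cancel s s', cancel s' s, mul_comm (s' : ℚ)]
  exact smul_lt_smul_of_pos_left (hf hxy) (inv_pos.2 (mul_pos (hpos s) (hpos s')))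

/-! ### Values of polynomials -/

/-- A valuation takes its finite values in its value group. -/
theorem exists_restrict_valueGroup {R Ω : Type*} [Ring R]
    [AddCommGroup Ω] [LinearOrder Ω] [IsOrderedAddMonoid Ω] (μ : AddValuation R (WithTop Ω)) :
    ∃ μ' : AddValuation R (WithTop (valueGroup μ)), ∀ f, (μ' f).map Subtype.val = μ f := by
  have hex : ∀ f, ∃ g : WithTop (valueGroup μ), g.map Subtype.val = μ f := by
    intro f
    rcases h : μ f with _ | ω
    · exact ⟨⊤, rfl⟩
    · exact ⟨((⟨ω, AddSubgroup.subset_closure ⟨f, h⟩⟩ : valueGroup μ) : WithTop _), rfl⟩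
  choose m hm using hex
  have hinj : Function.Injective (WithTop.map (Subtype.val : valueGroup μ → Ω)) :=
    WithTop.map_injective Subtype.val_injective
  have hle : ∀ x y : WithTop (valueGroup μ), x.map Subtype.val ≤ y.map Subtype.val ↔ x ≤ y :=
    fun x y => WithTop.map_le_iff _ Iff.rfl
  have hmap : ∀ x y : WithTop (valueGroup μ),
      (x + y).map Subtype.val = x.map Subtype.val + y.map Subtype.val :=
    WithTop.map_add (valueGroup μ).subtype
  refine ⟨AddValuation.of m (hinj ?_) (hinj ?_) (fun x y => ?_) (fun x y => hinj ?_), hm⟩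
  · rw [hm, AddValuation.map_zero]
    rfl
  · rw [hm, AddValuation.map_one]
    rfl
  · have h := μ.map_add x y
    rw [← hm, ← hm, ← hm, min_le_iff, hle, hle] at h
    exact min_le_iff.2 h
  · rw [hm, hmap, hm, hm, AddValuation.map_mul]

/-- The values of a valuation on `K[x]` lie in a subspace generated by the values of the constants
and one more element. -/
theorem exists_value_mem_sup_span {K Ω M : Type*} [Field K]
    [AddCommGroup Ω] [LinearOrder Ω] [IsOrderedAddMonoid Ω] [AddCommGroup M] [Module ℚ M]
    (μ : AddValuation K[X] (WithTop Ω)) (w : Ω →+ M)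
    (V : Submodule ℚ M) (hV : ∀ (a : K) (ω : Ω), μ (C a) = ω → w ω ∈ V) :
    ∃ θ : M, ∀ (f : K[X]) (ω : Ω), μ f = ω → w ω ∈ V ⊔ Submodule.span ℚ {θ} := by
  by_cases hall : ∀ (f : K[X]) (ω : Ω), μ f = ω → w ω ∈ V
  · exact ⟨0, fun f ω h => Submodule.mem_sup_left (hall f ω h)⟩
  push Not at hall
  have hex : ∃ n : ℕ, ∃ f : K[X], f.natDegree = n ∧ ∃ ω : Ω, μ f = ω ∧ w ω ∉ V := by
    obtain ⟨f, ω, h⟩ := hall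
    exact ⟨_, f, rfl, ω, h⟩
  classical
  obtain ⟨f, hfn, ω₀, hfω, hω₀⟩ := Nat.find_spec hex
  have hmin : ∀ r : K[X], r.natDegree < f.natDegree → ∀ ω : Ω, μ r = ω → w ω ∈ V := by
    intro r hr ω hω
    by_contra hne
    exact Nat.find_min hex (hfn ▸ hr) ⟨r, rfl, ω, hω, hne⟩
  have hfdeg : 0 < f.natDegree := by
    by_contra h0
    obtain ⟨a, ha⟩ := Polynomial.natDegree_eq_zero.1 (Nat.eq_zero_of_not_pos h0)
    exact hω₀ (hV a ω₀ (ha ▸ hfω))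
  have hf0 : f ≠ 0 := by
    rintro rfl
    simp at hfdeg
  have key : ∀ n : ℕ, ∀ g : K[X], g.natDegree < n → ∀ ω : Ω, μ g = ω →
      ∃ (k : ℕ), w ω - (k : ℚ) • w ω₀ ∈ V := by
    intro n
    induction n with
    | zero => exact fun g hg => absurd hg (Nat.not_lt_zero _)
    | succ n ih =>
      intro g hg ω hω
      by_cases hlt : g.natDegree < f.natDegree
      · exact ⟨0, by simpa using hmin g hlt ω hω⟩
      rw [not_lt] at hlt
      have hg' : f * (g / f) + g % f = g := EuclideanDomain.div_add_mod g f
      have hq : (g / f).natDegree < n := by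
        have hg0 : g ≠ 0 := by
          rintro rfl
          exact (hfdeg.trans_le hlt).ne' Polynomial.natDegree_zero
        have hdiv := Polynomial.degree_div_lt hg0 (Polynomial.natDegree_pos_iff_degree_pos.1 hfdeg)
        by_cases h0 : g / f = 0
        · rw [h0, Polynomial.natDegree_zero]
          omega
        · have := Polynomial.natDegree_lt_natDegree h0 hdiv
          omega
      have hr : (g % f).natDegree < f.natDegree := Polynomial.natDegree_mod_lt g hfdeg.ne'
      have hfq : ∀ ω' : Ω, μ (f * (g / f)) = ω' → ∃ k : ℕ, w ω' - ((k + 1 : ℕ) : ℚ) • w ω₀ ∈ V := by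
        intro ω' h
        rw [AddValuation.map_mul, hfω] at h
        obtain ⟨ω₁, hω₁⟩ : ∃ ω₁ : Ω, (ω₁ : WithTop Ω) = μ (g / f) := by
          refine WithTop.ne_top_iff_exists.1 fun h' => ?_
          rw [h', WithTop.add_top] at h
          exact WithTop.top_ne_coe h
        obtain ⟨k, hk⟩ := ih _ hq ω₁ hω₁.symm
        refine ⟨k, ?_⟩
        rw [← hω₁, ← WithTop.coe_add, WithTop.coe_inj] at h
        rw [← h, map_add w, Nat.cast_add, Nat.cast_one, add_smul, one_smul]
        convert hk using 1
        abel
      by_cases heq : μ (f * (g / f)) = μ (g % f)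
      · exfalso
        rcases hcase : μ (g % f) with _ | ω₁
        · have h1 : (⊤ : WithTop Ω) ≤ μ g := by
            rw [← hg']
            exact μ.map_le_add (heq.trans hcase).ge (le_of_eq hcase.symm)
          rw [hω] at h1
          exact WithTop.coe_ne_top (top_le_iff.1 h1)
        · obtain ⟨k, hk⟩ := hfq ω₁ (heq.trans hcase)
          have h1 := V.sub_mem (hmin _ hr ω₁ hcase) hk
          rw [sub_sub_cancel] at h1
          exact hω₀ ((V.smul_mem_iff (Nat.cast_ne_zero.2 (Nat.succ_ne_zero k))).1 h1)
      · have h1 := μ.map_add_of_distinct_val heq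
        rw [hg', hω] at h1
        rcases min_choice (μ (f * (g / f))) (μ (g % f)) with h2 | h2
        · obtain ⟨k, hk⟩ := hfq ω (h1.trans h2).symm
          exact ⟨k + 1, hk⟩
        · exact ⟨0, by simpa using hmin _ hr ω (h1.trans h2).symm⟩
  refine ⟨w ω₀, fun g ω h => ?_⟩
  obtain ⟨k, hk⟩ := key _ g (Nat.lt_succ_self _) ω h
  rw [← sub_add_cancel (w ω) ((k : ℚ) • w ω₀)]
  exact add_mem (Submodule.mem_sup_left hk)
    (Submodule.mem_sup_right (Submodule.smul_mem _ _ (Submodule.mem_span_singleton_self _)))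

/-- A valuation restricted to its value group has full value group. -/
theorem valueGroup_restrict_eq_top {R Ω : Type*} [Ring R]
    [AddCommGroup Ω] [LinearOrder Ω] [IsOrderedAddMonoid Ω]
    (μ : AddValuation R (WithTop Ω)) (μ' : AddValuation R (WithTop (valueGroup μ)))
    (hμ' : ∀ f, (μ' f).map Subtype.val = μ f) : valueGroup μ' = ⊤ := by
  rw [eq_top_iff]
  rintro ⟨ω, hω⟩ -
  induction hω using AddSubgroup.closure_induction with
  | mem ω h =>
    obtain ⟨f, hf⟩ := h
    exact AddSubgroup.subset_closure
      ⟨f, WithTop.map_injective Subtype.val_injective ((hμ' f).trans hf)⟩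
  | zero => exact zero_mem _
  | add x y hx hy ihx ihy => exact add_mem ihx ihy
  | neg x hx ihx => exact neg_mem ihx

/-- Transport of a valuation along an embedding of its value group. -/
theorem exists_transport {R Ω Ω' : Type*} [Ring R]
    [AddCommGroup Ω] [LinearOrder Ω] [IsOrderedAddMonoid Ω]
    [AddCommGroup Ω'] [LinearOrder Ω'] [IsOrderedAddMonoid Ω']
    (μ : AddValuation R (WithTop Ω)) (μ' : AddValuation R (WithTop (valueGroup μ)))
    (hμ' : ∀ f, (μ' f).map Subtype.val = μ f) (ρ : valueGroup μ →+ Ω') (hρ : StrictMono ρ) :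
    ∃ ν : AddValuation R (WithTop Ω'), (∀ f, ν f = (μ' f).map ρ) ∧ ValuationEquiv μ ν ∧
      valueGroup ν = ρ.range := by
  let ν : AddValuation R (WithTop Ω') :=
    μ'.map ρ.withTopMap rfl (WithTop.monotone_map_iff.2 hρ.monotone)
  have hν : ∀ f, ν f = (μ' f).map ρ := fun _ => rfl
  have hrange : valueGroup ν = ρ.range := by
    refine le_antisymm ((AddSubgroup.closure_le _).2 ?_) ?_
    · rintro ω ⟨f, hf⟩
      rw [hν] at hf
      obtain ⟨x, -, hx⟩ := WithTop.map_eq_some_iff.1 hf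
      exact ⟨x, hx⟩
    · rw [AddMonoidHom.range_eq_map, ← valueGroup_restrict_eq_top μ μ' hμ',
        AddSubgroup.map_le_iff_le_comap]
      refine (AddSubgroup.closure_le _).2 ?_
      rintro x ⟨f, hf⟩
      exact AddSubgroup.subset_closure ⟨f, by rw [hν, hf]; rfl⟩
  refine ⟨ν, hν, ?_, hrange⟩
  let ρ' : valueGroup μ →+ valueGroup ν := ρ.codRestrict _ fun x => hrange ▸ ⟨x, rfl⟩
  have hbij : Function.Bijective ρ' := by
    refine ⟨fun x y h => hρ.injective (congrArg Subtype.val h), ?_⟩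
    rintro ⟨y, hy⟩
    obtain ⟨x, rfl⟩ : y ∈ ρ.range := hrange ▸ hy
    exact ⟨x, rfl⟩
  let φ : valueGroup μ ≃+o valueGroup ν :=
    { AddEquiv.ofBijective ρ' hbij with map_le_map_iff' := fun {_ _} => hρ.le_iff_le }
  refine ⟨φ, fun f g hg => ?_⟩
  have : μ' f = g := WithTop.map_injective Subtype.val_injective ((hμ' f).trans hg)
  rw [hν, this, WithTop.map_map]
  rfl

/-- The embedding of the value group of a valued field into that of an extension to `K[X]`. -/
theorem exists_valueGroup_hom {K Γ Ω : Type*} [Field K]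
    [AddCommGroup Γ] [LinearOrder Γ] [IsOrderedAddMonoid Γ]
    [AddCommGroup Ω] [LinearOrder Ω] [IsOrderedAddMonoid Ω]
    (v : AddValuation K (WithTop Γ)) (hv : Function.Surjective v)
    (μ : AddValuation K[X] (WithTop Ω)) (hμ : ValuationEquiv (μ.comap C) v)
    (μ' : AddValuation K[X] (WithTop (valueGroup μ)))
    (hμ' : ∀ f, (μ' f).map Subtype.val = μ f) :
    ∃ ι : Γ →+ valueGroup μ, StrictMono ι ∧ ∀ a, μ' (C a) = (v a).map ι := by
  obtain ⟨φ, hφ⟩ := hμ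
  have hle : valueGroup (μ.comap C) ≤ valueGroup μ :=
    AddSubgroup.closure_mono fun ω ⟨a, ha⟩ => ⟨C a, ha⟩
  have hmem : ∀ γ : Γ, γ ∈ valueGroup v := fun γ => AddSubgroup.subset_closure (hv γ)
  let incl : Γ →+ valueGroup v := (AddMonoidHom.id Γ).codRestrict _ hmem
  let ι : Γ →+ valueGroup μ :=
    (AddSubgroup.inclusion hle).comp ((φ.symm : valueGroup v →+ valueGroup (μ.comap C)).comp incl)
  have hι : ∀ γ, (ι γ : Ω) = (φ.symm ⟨γ, hmem γ⟩ : Ω) := fun _ => rfl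
  refine ⟨ι, fun a b hab => ?_, fun a => ?_⟩
  · have : φ.symm ⟨a, hmem a⟩ < φ.symm ⟨b, hmem b⟩ := φ.symm.strictMono hab
    exact this
  · obtain ⟨w, hw⟩ := exists_restrict_valueGroup (μ.comap C)
    have h := hφ a (w a) (hw a).symm
    refine WithTop.map_injective Subtype.val_injective ?_
    rw [hμ', h]
    change (μ.comap C) a = _
    rw [← hw a]
    rcases w a with _ | x
    · rfl
    · change ((x : Ω) : WithTop Ω) = ((ι (φ x : Γ) : Ω) : WithTop Ω)
      rw [hι]
      change _ = ((φ.symm (φ x) : Ω) : WithTop Ω)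
      rw [OrderAddMonoidIso.symm_apply_apply]

theorem orderTop_surjective_of_isHahnEmbedding {Γ : Type*} [AddCommGroup Γ] [LinearOrder Γ]
    [IsOrderedAddMonoid Γ] {ℓ : Γ →+o HahnPower (Prin Γ)} (hℓ : IsHahnEmbedding ℓ) (i : Prin Γ) :
    ∃ a, (ofLex (ℓ a)).orderTop = i := by
  induction i using FiniteArchimedeanClass.ind with | mk a ha
  refine ⟨a, (FiniteArchimedeanClass.withTopOrderIso Γ).injective ?_⟩
  rw [← hℓ.orderTop_eq]
  rfl

/-- The value group of an extension from `K` to `K[X]` embeds into the Hahn power of the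
one-added-element hull of `Prin Γ`, over a given Hahn embedding of `Γ`. -/
theorem exists_valueGroup_embedding {K Γ Λ : Type*} [Field K]
    [AddCommGroup Γ] [LinearOrder Γ] [IsOrderedAddMonoid Γ]
    [AddCommGroup Λ] [LinearOrder Λ] [IsOrderedAddMonoid Λ]
    (v : AddValuation K (WithTop Γ)) {ℓ : Γ →+o HahnPower (Prin Γ)} (hℓ : IsHahnEmbedding ℓ)
    (μ : AddValuation K[X] (WithTop Λ)) (hμ : valueGroup μ = ⊤)
    (ι : Γ →+ Λ) (hι : StrictMono ι) (hμι : ∀ a, μ (C a) = (v a).map ι) :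
    ∃ ρ : Λ →+ HahnPower (OneAddedHull (Prin Γ)), StrictMono ρ ∧
      (∀ γ, ρ (ι γ) = OneAddedHull.extendHom (ℓ γ)) ∧
      ((∀ x, ρ x ∈ OneAddedHull.realBase (Prin Γ)) ∨ ∃ S : LowerSet (Prin Γ),
        (∀ x, ρ x ∈ OneAddedHull.supportedIn (OneAddedHull.insertOne S)) ∧
        ∃ x, (ofLex (ρ x)).orderTop = OneAddedHull.added S) := by
  let c : Λ →+ DivisibleHull Λ := DivisibleHull.coeAddMonoidHom Λ
  have hc : StrictMono c := fun a b hab => by simpa [c] using hab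
  have hℓmono : StrictMono ℓ := ℓ.monotone'.strictMono_of_injective hℓ.injective
  obtain ⟨j, hj, hjmk⟩ := DivisibleHull.exists_linear_extension (c.comp ι) (hc.comp hι)
  obtain ⟨e, he, hemk⟩ := DivisibleHull.exists_linear_extension
    (ℓ : Γ →+ HahnPower (Prin Γ)) hℓmono
  have hj1 : ∀ γ, j (DivisibleHull.coe γ) = c (ι γ) := fun γ => by simp [hjmk]
  have he1 : ∀ γ, e (DivisibleHull.coe γ) = ℓ γ := fun γ => by
    rw [hemk, PNat.one_coe, Nat.cast_one, inv_one]
    exact one_smul ℚ (ℓ γ)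
  have hcmk : ∀ (x : Λ) (s : ℕ+), DivisibleHull.mk x s = (s : ℚ)⁻¹ • c x := fun x s => by
    rw [eq_inv_smul_iff₀ (Nat.cast_ne_zero.2 s.ne_zero), Nat.cast_smul_eq_nsmul,
      DivisibleHull.nsmul_mk]
    refine DivisibleHull.mk_eq_mk_iff_smul_eq_smul.2 ?_
    simp
  have hsurj : ∀ i : Prin Γ, ∃ a, (ofLex (e a)).orderTop = i := fun i => by
    obtain ⟨a, ha⟩ := orderTop_surjective_of_isHahnEmbedding hℓ i
    exact ⟨DivisibleHull.coe a, by rw [he1, ha]⟩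
  obtain ⟨θ, hθ⟩ := exists_value_mem_sup_span μ c (LinearMap.range j) fun a ω h => by
    rw [hμι] at h
    obtain ⟨γ, -, rfl⟩ := WithTop.map_eq_some_iff.1 h
    exact ⟨_, hj1 γ⟩
  have hcmem : ∀ x, c x ∈ LinearMap.range j ⊔ Submodule.span ℚ {θ} := by
    intro x
    have hx : x ∈ valueGroup μ := hμ ▸ AddSubgroup.mem_top x
    induction hx using AddSubgroup.closure_induction with
    | mem ω h => exact hθ h.choose ω h.choose_spec
    | zero => rw [map_zero]; exact zero_mem _
    | add x y _ _ ihx ihy => rw [map_add]; exact add_mem ihx ihy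
    | neg x _ ihx => rw [map_neg]; exact neg_mem ihx
  have hspan : ∀ x : DivisibleHull Λ, ∃ (d : DivisibleHull Γ) (q : ℚ), x = j d + q • θ := by
    intro x
    induction x with | mk x s
    have h := Submodule.smul_mem _ (s : ℚ)⁻¹ (hcmem x)
    rw [← hcmk] at h
    obtain ⟨_, ⟨d, rfl⟩, z, hz, hx⟩ := Submodule.mem_sup.1 h
    obtain ⟨q, rfl⟩ := Submodule.mem_span_singleton.1 hz
    exact ⟨d, q, hx.symm⟩
  obtain ⟨E, hE, hEj, hEmem⟩ := CutRealization.exists_extension hj he hsurj θ hspan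
  refine ⟨E.toAddMonoidHom.comp c, hE.comp hc, fun γ => ?_, ?_⟩
  · change E (c (ι γ)) = _
    rw [← hj1, hEj, he1]
  · refine hEmem.imp (fun h x => h _) ?_
    rintro ⟨S, hS, x, hx⟩
    refine ⟨S, fun x => hS _, ?_⟩
    induction x with | mk x s
    rw [hcmk, map_smul, HahnPower.orderTop_smul
      (inv_ne_zero (Nat.cast_ne_zero.2 s.ne_zero))] at hx
    exact ⟨x, hx⟩

theorem mainTheorem8 {K Γ Ω : Type*} [Field K]
    [AddCommGroup Γ] [LinearOrder Γ] [IsOrderedAddMonoid Γ]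
    [AddCommGroup Ω] [LinearOrder Ω] [IsOrderedAddMonoid Ω]
    (v : AddValuation K (WithTop Γ)) (hv : Function.Surjective v)
    (ℓ : Γ →+o HahnPower (Prin Γ)) (hℓ : IsHahnEmbedding ℓ)
    (μ : AddValuation K[X] (WithTop Ω)) (hμ : ValuationEquiv (μ.comap C) v) :
    ∃ ν : AddValuation K[X] (WithTop (HahnPower (OneAddedHull (Prin Γ)))),
      ValuationEquiv μ ν ∧
      (∀ a : K, ν (C a) = (v a).map fun γ => OneAddedHull.extendHom (ℓ γ)) ∧
      (valueGroup ν : Set (HahnPower (OneAddedHull (Prin Γ)))) ⊆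
        OneAddedHull.realSme (Prin Γ) ∧
      (CommensurableOver v ν →
        valueGroup ν ≤
          relDivisibleHull (OneAddedHull.extendHom.comp (ℓ : Γ →+ HahnPower (Prin Γ))).range) ∧
      (PreservesRankOver v ν → valueGroup ν ≤ OneAddedHull.realBase (Prin Γ)) := by
  obtain ⟨μ', hμ'⟩ := exists_restrict_valueGroup μ
  obtain ⟨ι, hι, hμι⟩ := exists_valueGroup_hom v hv μ hμ μ' hμ'
  obtain ⟨ρ, hρ, hρι, hmem⟩ :=
    exists_valueGroup_embedding v hℓ μ' (valueGroup_restrict_eq_top μ μ' hμ') ι hι hμι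
  obtain ⟨ν, hν, hequiv, hrange⟩ := exists_transport μ μ' hμ' ρ hρ
  have hC : ∀ a : K, ν (C a) = (v a).map fun γ => OneAddedHull.extendHom (ℓ γ) := by
    intro a
    rw [hν, hμι, WithTop.map_map]
    exact congrArg (fun g => (v a).map g) (funext hρι)
  have hind : ∀ κ : Γ →+o valueGroup ν, IsInducedEmbedding v ν κ → ∀ γ,
      (κ γ : HahnPower (OneAddedHull (Prin Γ))) = OneAddedHull.extendHom (ℓ γ) := by
    intro κ hκ γ
    obtain ⟨a, ha⟩ := hv γ
    have h := (hκ.2 a).symm.trans (hC a)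
    rw [ha] at h
    exact WithTop.coe_injective h
  refine ⟨ν, hequiv, hC, ?_, ?_, ?_⟩
  · rintro x hx
    obtain ⟨y, rfl⟩ : x ∈ ρ.range := hrange ▸ hx
    rcases hmem with h | ⟨S, hS, -⟩
    · exact Set.mem_iUnion.2 ⟨⊥, OneAddedHull.realBase_le_supportedIn ⊥ (h y)⟩
    · exact Set.mem_iUnion.2 ⟨S, hS y⟩
  · rintro ⟨κ, hκ, hcomm⟩ x hx
    obtain ⟨n, hn, γ, hγ⟩ := hcomm ⟨x, hx⟩
    refine ⟨n, hn, γ, ?_⟩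
    have h := congrArg Subtype.val hγ
    rw [hind κ hκ] at h
    exact h
  · rintro ⟨κ, hκ, hrank⟩ x hx
    obtain ⟨y, rfl⟩ : x ∈ ρ.range := hrange ▸ hx
    rcases hmem with h | ⟨S, -, z, hz⟩
    · exact h y
    exfalso
    have hzmem : ρ z ∈ valueGroup ν := hrange ▸ ⟨z, rfl⟩
    have hz0 : (⟨ρ z, hzmem⟩ : valueGroup ν) ≠ 0 := by
      intro h
      have h' : ρ z = 0 := congrArg Subtype.val h
      rw [h', ofLex_zero, HahnSeries.orderTop_zero] at hz
      exact WithTop.top_ne_coe hz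
    obtain ⟨q, hq⟩ := hrank (FiniteArchimedeanClass.mk _ hz0)
    induction q using ArchimedeanClass.ind with | mk γ
    let sub : valueGroup ν →+o HahnPower (OneAddedHull (Prin Γ)) :=
      { (valueGroup ν).subtype with monotone' := fun _ _ h => h }
    have h := congrArg (ArchimedeanClass.orderHom sub) hq
    rw [ArchimedeanClass.orderHom_mk, ArchimedeanClass.orderHom_mk,
      FiniteArchimedeanClass.val_mk, ArchimedeanClass.orderHom_mk] at h
    change ArchimedeanClass.mk (κ γ : HahnPower (OneAddedHull (Prin Γ))) =
      ArchimedeanClass.mk (ρ z) at h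
    have h1 := (HahnSeries.archimedeanClassMk_eq_archimedeanClassMk_iff.1 h).1
    rw [hind κ hκ, OneAddedHull.orderTop_extendHom, hz] at h1
    obtain ⟨i, -, hi⟩ := WithTop.map_eq_some_iff.1 h1
    cases hi
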